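/- Define real numbers $P^{(k)}(n)$, $1\le k\le n$ (the P-polynomials), by $P^{(n)}(n)=\frac{6^n}{(2n+1)!}$ and, for $1<l\le n$, $$P^{(n-l+1)}(n)=6^n\,\frac{l-1}{2n+l}\sum_{i=l-1}^{n-1}\frac{P^{(i-l+2)}(i)}{6^i\,(2n-2i)!};$$ in particular $P^{(1)}(n)=\frac1n$. For real $y$ and $n\ge1$ put $$c_n(y)=\sum_{m=1}^{\infty}\frac{(-1)^{m+1}m(m+1)\,P^{(n)}(m+n-1)}{(2m+2n-3)(2m+2n-2)(2m+2n-1)(2m+2n)}\,y^{2m},\qquad S(y)=\sum_{n=1}^\infty c_n(y)\,y^{2n}.$$ Let $$A=\ln\frac{\sqrt2+\sqrt3}{2\sqrt2},\qquad B=\ln\frac{2\sqrt3}{\sqrt2+\sqrt3},\qquad C=\ln\frac{5+2\sqrt6}{4\sqrt6}.$$ Then, for each of the six values $$y\in\Big\{\tfrac{\ln(4/3)}{2\sqrt6},\ \tfrac{\ln(9/8)}{2\sqrt6},\ \tfrac{\ln(3/2)}{4\sqrt6},\ \tfrac{A}{2\sqrt6},\ \tfrac{B}{2\sqrt6},\ \tfrac{C}{2\sqrt6}\Big\},$$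 all the series $c_n(y)$, $n\ge1$, and the series $S(y)$ converge absolutely, and $$\begin{aligned} \zeta(3)={}&\tfrac{48\pi^2}{5}\ln\tfrac32+\tfrac{6\pi^2}{5}\ln\tfrac43-\tfrac{2\pi^2}{5}\ln\tfrac98-\tfrac{96\pi^2}{5}A-\tfrac{48\pi^2}{5}B+\tfrac{24\pi^2}{5}C-\tfrac{6\pi^2}{5}\ln2\\ &-\tfrac{108}{5}\ln^2\tfrac32-\tfrac{27}{5}\ln^2\tfrac43+\tfrac95\ln^2\tfrac98+\tfrac{432}{5}A^2+\tfrac{432}{5}B^2-\tfrac{108}{5}C^2\\ &-\tfrac35\ln^3\tfrac43-\tfrac65\ln^3\tfrac32+\tfrac15\ln^3\tfrac98+\tfrac{48}{5}A^3-\tfrac{48}{5}B^3-\tfrac{12}{5}C^3\\ &+\tfrac{28}{5}\ln^32-\tfrac45\ln^33-\tfrac45\ln^3\tfrac32+\tfrac85\ln^3\tfrac43-\tfrac{24}{5}\ln\tfrac43\,\ln^22+\tfrac{12}{5}\ln3\,\ln^2\tfrac32\\ &+\tfrac{18}{5}\ln^2\tfrac43\,\ln\ln\tfrac43+\tfrac{72}{5}\ln^2\tfrac32\,\ln\!\big(\tfrac12\ln\tfrac32\big)-\tfrac65\ln^2\tfrac98\,\ln\ln\tfrac98\\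 &-\tfrac{288}{5}A^2\ln A-\tfrac{288}{5}B^2\ln B+\tfrac{72}{5}C^2\ln C\\ &+\tfrac{864}{5}S\Big(\tfrac{\ln(4/3)}{2\sqrt6}\Big)-\tfrac{288}{5}S\Big(\tfrac{\ln(9/8)}{2\sqrt6}\Big)+\tfrac{13824}{5}S\Big(\tfrac{\ln(3/2)}{4\sqrt6}\Big)\\ &-\tfrac{13824}{5}S\Big(\tfrac{A}{2\sqrt6}\Big)-\tfrac{13824}{5}S\Big(\tfrac{B}{2\sqrt6}\Big)+\tfrac{3456}{5}S\Big(\tfrac{C}{2\sqrt6}\Big). \end{aligned}$$ -/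

import Mathlib

open Real

noncomputable section

/-- `pDiag l n` is the value `P^{(n-l+1)}(n)` of the P-polynomials, given by the initial values
`P^{(n)}(n) = 6^n / (2n+1)!` (the case `l = 1`) and, for `l > 1`, by the recursion
`P^{(n-l+1)}(n) = 6^n (l-1)/(2n+l) * ∑_{i=l-1}^{n-1} P^{(i-l+2)}(i) / (6^i (2n-2i)!)`. -/
def pDiag : ℕ → ℕ → ℝ
  | 0, _ => 0
  | 1, n => 6 ^ n / ((2 * n + 1).factorial : ℝ)
  | l + 2, n =>
      6 ^ n * ((l + 1 : ℝ) / (2 * n + (l + 2))) *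
        ∑ i ∈ Finset.Ico (l + 1) n, pDiag (l + 1) i / (6 ^ i * ((2 * n - 2 * i).factorial : ℝ))

/-- The value `P^{(l)}(n)` of the `l`-th P-polynomial at the integer `n`, for `1 ≤ l ≤ n`. -/
def pPoly (l n : ℕ) : ℝ := pDiag (n + 1 - l) n

/-- Initial values of the P-polynomials. -/
theorem pPoly_self (n : ℕ) : pPoly n n = 6 ^ n / ((2 * n + 1).factorial : ℝ) := by
  simp [pPoly, pDiag]

/-- The recursion relation of the P-polynomials. -/
theorem pPoly_rec (l n : ℕ) (hl : 1 < l) (hn : l ≤ n) :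
    pPoly (n - l + 1) n = 6 ^ n * (((l : ℝ) - 1) / (2 * n + l)) *
      ∑ i ∈ Finset.Ico (l - 1) n,
        pPoly (i + 2 - l) i / (6 ^ i * ((2 * n - 2 * i).factorial : ℝ)) := by
  obtain ⟨k, rfl⟩ : ∃ k, l = k + 2 := ⟨l - 2, by omega⟩
  have h1 : n + 1 - (n - (k + 2) + 1) = k + 2 := by omega
  have h2 : k + 2 - 1 = k + 1 := by omega
  rw [pPoly, h1, pDiag, h2]
  congr 1
  · push_cast
    ring
  · refine Finset.sum_congr rfl fun i hi => ?_
    have h3 : i + 1 - (i + 2 - (k + 2)) = k + 1 := by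
      have := (Finset.mem_Ico.mp hi).1
      omega
    rw [pPoly, h3]

/-- The first P-polynomial is `P^{(1)}(n) = 1/n`. -/
theorem pPoly_one (n : ℕ) (hn : 1 ≤ n) : pPoly 1 n = 1 / n := by
  have key : ∀ m : ℕ, pDiag (m + 1) (m + 1) = 1 / ((m : ℝ) + 1) := by
    intro m
    induction m with
    | zero => norm_num [pDiag, Nat.factorial]
    | succ k ih =>
      have h1 : 2 * (k + 1 + 1) - 2 * (k + 1) = 2 := by omega
      rw [pDiag, Nat.Ico_succ_singleton, Finset.sum_singleton, ih, h1]
      have : (k : ℝ) + 1 ≠ 0 := by positivity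
      have : 2 * ((k : ℝ) + 1 + 1) + (k + 2) ≠ 0 := by positivity
      have : (k : ℝ) + 1 + 1 ≠ 0 := by positivity
      push_cast [Nat.factorial]
      field_simp
      ring
  obtain ⟨m, rfl⟩ : ∃ m, n = m + 1 := ⟨n - 1, by omega⟩
  simpa [pPoly] using key m

/-- The summand with index `m ≥ 1` of the series that defines the coefficient `c_n`. -/
def coeffTerm (y : ℝ) (n m : ℕ) : ℝ :=
  (-1) ^ (m + 1) * m * (m + 1) * pPoly n (m + n - 1) /
      ((2 * m + 2 * n - 3) * (2 * m + 2 * n - 2) * (2 * m + 2 * n - 1) * (2 * m + 2 * n)) *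
    y ^ (2 * m)

/-- The coefficient `c_n = ∑_{m ≥ 1} coeffTerm y n m`, for `n ≥ 1`. -/
def coeff (y : ℝ) (n : ℕ) : ℝ := ∑' m : ℕ, coeffTerm y n (m + 1)

/-- The series `∑_{n ≥ 1} c_n y^{2n}`. -/
def pSeries (y : ℝ) : ℝ := ∑' n : ℕ, coeff y (n + 1) * y ^ (2 * (n + 1))

/-- The series `∑_{n ≥ 1} c_n y^{2n}` and all the series that define its coefficients converge. -/
def PSeriesConverges (y : ℝ) : Prop :=
  (∀ n : ℕ, Summable fun m : ℕ => coeffTerm y (n + 1) (m + 1)) ∧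
    Summable fun n : ℕ => coeff y (n + 1) * y ^ (2 * (n + 1))

/-- The first nested-radical argument. -/
def radA : ℝ := (√2 + √3) / (2 * √2)

/-- The second nested-radical argument. -/
def radB : ℝ := 2 * √3 / (√2 + √3)

/-- The third nested-radical argument. -/
def radC : ℝ := (5 + 2 * √6) / (4 * √6)

end

/-! Put `v = sinh t / t - 1`, a power series in `T = t ^ 2` without constant term. The recursion of
the P-polynomials is the one satisfied by the coefficients of the powers of `v`: the diagonal with
parameter `l` is `6 ^ n / l` times the coefficient of `T ^ n` in `v ^ l` (`pDiag_eq_coeff`). At `y =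
t / √6` the powers of 6 cancel up to one factor. The factor `m (m + 1)` then turns the sum over `m`
into the binomial expansion of `1 - (1 + v) ^ (-2) = 1 - (t / sinh t) ^ 2`, and the four linear
denominators are those of a fourfold integration.

Hence `6 S(t / √6)` is the fourfold integral from 0 of `1 / t ^ 2 - 1 / sinh t ^ 2`. Its successive
integrals are `coth t - 1 / t`, `log (sinh t / t)`, a dilogarithm and a trilogarithm of `exp (-2
t)`. So `S(x / (2 √6))` is elementary up to `Li₃(1) - Li₃(exp (-x))` (`pSeries_eq_polyLog`).

It remains to relate the values of `Li₃` at the six numbers `exp (-x)`, that is 3/4, 8/9, `s =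
√(2/3)`, `2s/(1+s)`, `(1+s)/2` and `4s/(1+s)²`. Landen's identity, a case of Spence's identity and
the duplication formula give one relation (`polyLog_three_ladder`). Its weights add up to -408 while
`ζ(3)` enters with -413, so the combination of the six closed forms leaves `5 ζ(3)`. -/

/-! ### Polylogarithm series: derivatives, special values, duplication -/

/-- The polylogarithm of integral order `s`, as a power series on `[-1, 1]`. -/
noncomputable def polyLog (s : ℕ) (x : ℝ) : ℝ := ∑' n : ℕ, x ^ (n + 1) / ((n : ℝ) + 1) ^ s

/-- Free exponents `e n` let this serve both the polylogarithms, with exponents `n`, and the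
iterated integrals, with exponents `2 k + j`. -/
theorem hasDerivAt_tsum_mul_pow_div {a : ℕ → ℝ} {e : ℕ → ℕ} {r t : ℝ}
    (ha : Summable fun n => |a n| * r ^ e n) (ht : |t| < r) :
    HasDerivAt (fun x => ∑' n, a n * x ^ (e n + 1) / ((e n : ℝ) + 1)) (∑' n, a n * t ^ e n) t := by
  have hr : 0 < r := (abs_nonneg t).trans_lt ht
  refine hasDerivAt_tsum_of_isPreconnected (g := fun n x => a n * x ^ (e n + 1) / ((e n : ℝ) + 1))
    (g' := fun n x => a n * x ^ e n) (t := Set.Ioo (-r) r) (y₀ := 0) ha isOpen_Ioo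
    isPreconnected_Ioo (fun n y _ => ?_) (fun n y hy => ?_) ⟨by linarith, hr⟩ ?_ (abs_lt.mp ht)
  · have hn : (e n : ℝ) + 1 ≠ 0 := by positivity
    have h := (((hasDerivAt_id y).pow (e n + 1)).const_mul (a n)).div_const ((e n : ℝ) + 1)
    refine h.congr_deriv ?_
    simp only [id, Nat.add_sub_cancel]
    push_cast
    field_simp
  · rw [norm_mul, norm_pow, Real.norm_eq_abs, Real.norm_eq_abs]
    gcongr
    exact (abs_lt.mpr hy).le
  · simp

/-- The engine of every functional equation and every integration here: all terms go to one side,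
the derivative vanishes inside the interval, and the constant is read off at 0. At 0 only continuity
is needed, since logarithms are singular there. -/
theorem eq_of_hasDerivAt_zero {f : ℝ → ℝ} {b : ℝ} (hb : 0 < b)
    (hc : ContinuousOn f (Set.Icc 0 b)) (hd : ∀ x ∈ Set.Ioo 0 b, HasDerivAt f 0 x) :
    f b = f 0 := by
  obtain ⟨c, -, h⟩ := exists_hasDerivAt_eq_slope f (fun _ => 0) hb hc hd
  rw [eq_comm, div_eq_zero_iff] at h
  rcases h with h | h <;> linarith

theorem summable_polyLog {s : ℕ} (hs : 2 ≤ s) {x : ℝ} (hx : |x| ≤ 1) :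
    Summable fun n : ℕ => x ^ (n + 1) / ((n : ℝ) + 1) ^ s := by
  have h : Summable fun n : ℕ => 1 / ((n : ℝ) + 1) ^ s := by
    exact_mod_cast (summable_nat_add_iff 1).mpr (Real.summable_one_div_nat_pow.mpr hs)
  refine Summable.of_norm_bounded h fun n => ?_
  rw [norm_div, norm_pow, Real.norm_eq_abs, Real.norm_of_nonneg (by positivity)]
  gcongr
  exact pow_le_one₀ (abs_nonneg x) hx

theorem continuousOn_polyLog {s : ℕ} (hs : 2 ≤ s) :
    ContinuousOn (polyLog s) (Set.Icc (-1) 1) := by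
  have h : Summable fun n : ℕ => 1 / ((n : ℝ) + 1) ^ s := by
    exact_mod_cast (summable_nat_add_iff 1).mpr (Real.summable_one_div_nat_pow.mpr hs)
  refine continuousOn_tsum (fun n => by fun_prop) h fun n x hx => ?_
  rw [norm_div, norm_pow, Real.norm_eq_abs, Real.norm_of_nonneg (by positivity)]
  gcongr
  exact pow_le_one₀ (abs_nonneg x) (abs_le.mpr hx)

theorem ContinuousOn.polyLog {s : ℕ} (hs : 2 ≤ s) {f : ℝ → ℝ} {S : Set ℝ}
    (hf : ContinuousOn f S) (h : ∀ x ∈ S, -1 ≤ f x ∧ f x ≤ 1) :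
    ContinuousOn (fun x => polyLog s (f x)) S :=
  (continuousOn_polyLog hs).comp hf h

theorem hasDerivAt_polyLog (s : ℕ) {x : ℝ} (hx : |x| < 1) (h0 : x ≠ 0) :
    HasDerivAt (polyLog (s + 1)) (polyLog s x / x) x := by
  obtain ⟨r, hr, hr1⟩ := exists_between hx
  have hr0 : 0 ≤ r := (abs_nonneg x).trans hr.le
  have ha : Summable fun n : ℕ => |1 / ((n : ℝ) + 1) ^ s| * r ^ n := by
    refine Summable.of_nonneg_of_le (fun n => by positivity) (fun n => ?_)
      (summable_geometric_of_lt_one hr0 hr1)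
    rw [abs_of_nonneg (by positivity)]
    refine mul_le_of_le_one_left (by positivity) ?_
    rw [div_le_one (by positivity)]
    exact one_le_pow₀ (by linarith [n.cast_nonneg (α := ℝ)])
  have h := hasDerivAt_tsum_mul_pow_div (e := fun n => n) ha hr
  have hf : polyLog (s + 1) =
      fun x => ∑' n : ℕ, 1 / ((n : ℝ) + 1) ^ s * x ^ (n + 1) / ((n : ℝ) + 1) := by
    funext y
    refine tsum_congr fun n => ?_
    have : (n : ℝ) + 1 ≠ 0 := by positivity
    field_simp
    ring
  rw [hf]
  refine h.congr_deriv ?_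
  rw [polyLog, ← tsum_div_const]
  refine tsum_congr fun n => ?_
  field_simp
  ring

theorem HasDerivAt.polyLog (s : ℕ) {f : ℝ → ℝ} {f' x : ℝ} (hf : HasDerivAt f f' x)
    (h1 : -1 < f x) (h2 : f x < 1) (h0 : f x ≠ 0) :
    HasDerivAt (fun x => polyLog (s + 1) (f x)) (polyLog s (f x) / f x * f') x :=
  (hasDerivAt_polyLog s (abs_lt.mpr ⟨h1, h2⟩) h0).comp x hf

theorem polyLog_one_left {x : ℝ} (h1 : -1 < x) (h2 : x < 1) : polyLog 1 x = -log (1 - x) := by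
  simpa [polyLog] using (hasSum_pow_div_log_of_abs_lt_one (abs_lt.mpr ⟨h1, h2⟩)).tsum_eq

@[simp] theorem polyLog_zero_right (s : ℕ) : polyLog s 0 = 0 := by
  simp [polyLog]

theorem polyLog_two_one : polyLog 2 1 = π ^ 2 / 6 := by
  have h := (hasSum_nat_add_iff' 1).mpr hasSum_zeta_two
  simpa [polyLog] using h.tsum_eq

theorem polyLog_three_one : ((polyLog 3 1 : ℝ) : ℂ) = riemannZeta 3 := by
  have h := zeta_nat_eq_tsum_of_gt_one (k := 3) (by norm_num)
  have hs : Summable fun n : ℕ => 1 / (n : ℂ) ^ 3 := by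
    simpa using Complex.ofRealCLM.summable
      (Real.summable_one_div_nat_pow.mpr (by norm_num : 1 < 3))
  rw [hs.tsum_eq_zero_add] at h
  push_cast at h
  rw [h, polyLog]
  push_cast
  simp

/-- Odd powers cancel and even powers double. The exponent is `n + 1`, so the odd powers sit at the
even indices. -/
theorem polyLog_add_polyLog_neg {s : ℕ} (hs : 1 ≤ s) {x : ℝ} (hx : |x| ≤ 1) :
    polyLog (s + 1) x + polyLog (s + 1) (-x) = polyLog (s + 1) (x ^ 2) / 2 ^ s := by
  have h1 := summable_polyLog (s := s + 1) (by omega) hx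
  have h2 := summable_polyLog (s := s + 1) (x := -x) (by omega) (by rwa [abs_neg])
  have h3 := summable_polyLog (s := s + 1) (x := x ^ 2) (by omega)
    (by rw [abs_pow]; exact pow_le_one₀ (abs_nonneg x) hx)
  have h0 (n : ℕ) : x ^ (2 * n + 1) / (((2 * n : ℕ) : ℝ) + 1) ^ (s + 1) +
      (-x) ^ (2 * n + 1) / (((2 * n : ℕ) : ℝ) + 1) ^ (s + 1) = 0 := by
    rw [Odd.neg_pow ⟨n, rfl⟩]
    ring
  have h4 (n : ℕ) : x ^ (2 * n + 1 + 1) / (((2 * n + 1 : ℕ) : ℝ) + 1) ^ (s + 1) +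
      (-x) ^ (2 * n + 1 + 1) / (((2 * n + 1 : ℕ) : ℝ) + 1) ^ (s + 1) =
      (x ^ 2) ^ (n + 1) / ((n : ℝ) + 1) ^ (s + 1) / 2 ^ s := by
    have h5 : (((2 * n + 1 : ℕ) : ℝ) + 1) = 2 * (n + 1) := by push_cast; ring
    have h6 : (n : ℝ) + 1 ≠ 0 := by positivity
    rw [Even.neg_pow ⟨n + 1, by ring⟩, h5, mul_pow, ← pow_mul]
    field_simp
    ring
  simp only [polyLog]
  rw [← h1.tsum_add h2, ← tsum_even_add_odd]
  · simp only [h0, h4, tsum_zero, zero_add, tsum_div_const]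
  · simp only [h0]; exact summable_zero
  · simp only [h4]; exact h3.div_const _

/-! ### Functional equations of the dilogarithm -/

/-- The product is `(x log x) * (log (1 + a x) / x)`; the first factor tends to 0 and the second to
`a`. The convention `log 0 = 0` supplies the right value at 0. -/
theorem tendsto_log_mul_log_one_add (a : ℝ) :
    ContinuousWithinAt (fun x => log x * log (1 + a * x)) (Set.Ici 0) 0 := by
  have h1 : HasDerivAt (fun x => log (1 + a * x)) a 0 := by
    have : HasDerivAt (fun x : ℝ => 1 + a * x) a 0 := by
      simpa using ((hasDerivAt_id (0 : ℝ)).const_mul a).const_add 1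
    simpa using this.log (by simp)
  have h2 := h1.continuousAt_div
  have h3 := (Real.continuous_mul_log.continuousAt (x := 0)).mul h2
  refine (h3.continuousWithinAt (s := Set.Ici 0)).congr (fun x hx => ?_) (by simp)
  rcases eq_or_ne x 0 with rfl | h
  · simp
  · simp [Function.update_of_ne h]
    field_simp

theorem continuousOn_log_mul_log_one_add {a b : ℝ} (h : ∀ x ∈ Set.Icc 0 b, 0 < 1 + a * x) :
    ContinuousOn (fun x => log x * log (1 + a * x)) (Set.Icc 0 b) := by
  intro x hx
  rcases eq_or_ne x 0 with rfl | h0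
  · exact (tendsto_log_mul_log_one_add a).mono Set.Icc_subset_Ici_self
  · have h1 : ContinuousAt (fun x : ℝ => 1 + a * x) x := by fun_prop
    exact ((continuousAt_log h0).mul (h1.log (h x hx).ne')).continuousWithinAt

theorem continuousOn_log_mul_log_one_sub {b : ℝ} (hb : b < 1) :
    ContinuousOn (fun x => log x * log (1 - x)) (Set.Icc 0 b) := by
  have := continuousOn_log_mul_log_one_add (a := -1) (b := b) fun x hx => by linarith [hx.2]
  simpa only [neg_one_mul, ← sub_eq_add_neg] using this

theorem continuousOn_log_mul_log_one_add' (b : ℝ) :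
    ContinuousOn (fun x => log x * log (1 + x)) (Set.Icc 0 b) := by
  have := continuousOn_log_mul_log_one_add (a := 1) (b := b) fun x hx => by linarith [hx.1]
  simpa only [one_mul] using this

theorem hasDerivAt_one_sub (x : ℝ) : HasDerivAt (fun x : ℝ => 1 - x) (-1) x := by
  simpa using (hasDerivAt_id x).const_sub 1

theorem hasDerivAt_one_add (x : ℝ) : HasDerivAt (fun x : ℝ => 1 + x) 1 x := by
  simpa using (hasDerivAt_id x).const_add 1

/-- Euler's reflection formula. -/
theorem polyLog_two_add_one_sub {b : ℝ} (h0 : 0 < b) (h1 : b < 1) :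
    polyLog 2 b + polyLog 2 (1 - b) = π ^ 2 / 6 - log b * log (1 - b) := by
  have key := eq_of_hasDerivAt_zero
    (f := fun x => polyLog 2 x + polyLog 2 (1 - x) + log x * log (1 - x)) h0 ?_ ?_
  · simp [polyLog_two_one] at key
    linarith
  · refine ContinuousOn.add (.add ?_ ?_) (continuousOn_log_mul_log_one_sub h1)
    · exact continuousOn_id.polyLog le_rfl fun x hx =>
        ⟨by simp; linarith [hx.1], by simp; linarith [hx.2]⟩
    · exact ContinuousOn.polyLog le_rfl (by fun_prop) fun x hx => ⟨by linarith [hx.2], by linarith [hx.1]⟩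
  · rintro x ⟨hx0, hxb⟩
    have hx1 : x < 1 := hxb.trans h1
    have hs : 1 - x ≠ 0 := by linarith
    have d1 := (hasDerivAt_id x).polyLog 1 (by simp; linarith) (by simpa) (by simpa using hx0.ne')
    have d2 := (hasDerivAt_one_sub x).polyLog 1 (by linarith) (by linarith) hs
    have d3 := (hasDerivAt_log hx0.ne').mul ((hasDerivAt_one_sub x).log hs)
    refine ((d1.add d2).add d3).congr_deriv ?_
    simp only [id]
    rw [polyLog_one_left (by linarith) hx1, polyLog_one_left (by linarith) (by linarith), sub_sub_cancel]
    field_simp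
    ring

theorem hasDerivAt_neg_div_one_sub {x : ℝ} (h : 1 - x ≠ 0) :
    HasDerivAt (fun x : ℝ => -x / (1 - x)) (-1 / (1 - x) ^ 2) x := by
  refine ((hasDerivAt_neg x).div (hasDerivAt_one_sub x) h).congr_deriv ?_
  field_simp
  ring

theorem neg_div_one_sub_bounds {x : ℝ} (h1 : x ≤ 1 / 2) :
    -1 ≤ -x / (1 - x) ∧ -x / (1 - x) ≤ 1 := by
  have : 0 < 1 - x := by linarith
  rw [le_div_iff₀ this, div_le_iff₀ this]
  constructor <;> linarith

theorem neg_div_one_sub_bounds' {x : ℝ} (h0 : 0 < x) (h1 : x < 1 / 2) :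
    -1 < -x / (1 - x) ∧ -x / (1 - x) < 0 := by
  have : 0 < 1 - x := by linarith
  rw [lt_div_iff₀ this, div_lt_iff₀ this]
  constructor <;> linarith

theorem continuousOn_neg_div_one_sub {b : ℝ} (hb : b < 1) :
    ContinuousOn (fun x : ℝ => -x / (1 - x)) (Set.Icc 0 b) :=
  ContinuousOn.div (by fun_prop) (by fun_prop) fun x hx => by linarith [hx.2]

theorem continuousOn_log_one_sub {b : ℝ} (hb : b < 1) :
    ContinuousOn (fun x : ℝ => log (1 - x)) (Set.Icc 0 b) :=
  ContinuousOn.log (by fun_prop) fun x hx => by linarith [hx.2]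

theorem log_one_sub_neg_div {x : ℝ} (h : 0 < 1 - x) :
    log (1 - -x / (1 - x)) = -log (1 - x) := by
  rw [← log_inv]
  congr 1
  field_simp
  ring

/-- Landen's identity for the dilogarithm. -/
theorem polyLog_two_landen {b : ℝ} (h0 : 0 < b) (h1 : b ≤ 1 / 2) :
    polyLog 2 (-b / (1 - b)) + polyLog 2 b = - log (1 - b) ^ 2 / 2 := by
  have hb : b < 1 := by linarith
  have key := eq_of_hasDerivAt_zero
    (f := fun x => polyLog 2 (-x / (1 - x)) + polyLog 2 x + log (1 - x) ^ 2 / 2) h0 ?_ ?_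
  · simp at key
    linarith
  · refine ContinuousOn.add (.add ?_ ?_) (((continuousOn_log_one_sub hb).pow 2).div_const 2)
    · exact (continuousOn_neg_div_one_sub hb).polyLog le_rfl fun x hx =>
        neg_div_one_sub_bounds (hx.2.trans h1)
    · exact continuousOn_id.polyLog le_rfl fun x hx =>
        ⟨by simp; linarith [hx.1], by simp; linarith [hx.2]⟩
  · rintro x ⟨hx0, hxb⟩
    have hx1 : 0 < 1 - x := by linarith
    have hs := neg_div_one_sub_bounds' hx0 (hxb.trans_le h1)
    have d1 := (hasDerivAt_neg_div_one_sub hx1.ne').polyLog 1 hs.1 (by linarith) hs.2.ne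
    have d2 := (hasDerivAt_id x).polyLog 1 (by simp; linarith) (by simp; linarith) (by simpa using hx0.ne')
    have d3 := (((hasDerivAt_one_sub x).log hx1.ne').pow 2).div_const 2
    refine ((d1.add d2).add d3).congr_deriv ?_
    simp only [id]
    rw [polyLog_one_left hs.1 (by linarith), polyLog_one_left (by linarith) (by linarith),
      log_one_sub_neg_div hx1]
    field_simp
    ring

theorem hasDerivAt_cayley {x : ℝ} (h : 1 + x ≠ 0) :
    HasDerivAt (fun x : ℝ => (1 - x) / (1 + x)) (-2 / (1 + x) ^ 2) x := by
  refine ((hasDerivAt_one_sub x).div (hasDerivAt_one_add x) h).congr_deriv ?_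
  field_simp
  ring

theorem hasDerivAt_neg_cayley {x : ℝ} (h : 1 + x ≠ 0) :
    HasDerivAt (fun x : ℝ => -((1 - x) / (1 + x))) (2 / (1 + x) ^ 2) x :=
  (hasDerivAt_cayley h).neg.congr_deriv (by ring)

theorem cayley_bounds {x : ℝ} (h0 : 0 ≤ x) (h1 : x ≤ 1) :
    0 ≤ (1 - x) / (1 + x) ∧ (1 - x) / (1 + x) ≤ 1 := by
  have : 0 < 1 + x := by linarith
  rw [le_div_iff₀ this, div_le_iff₀ this]
  constructor <;> linarith

theorem cayley_bounds' {x : ℝ} (h0 : 0 < x) (h1 : x < 1) :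
    0 < (1 - x) / (1 + x) ∧ (1 - x) / (1 + x) < 1 := by
  have : 0 < 1 + x := by linarith
  rw [lt_div_iff₀ this, div_lt_iff₀ this]
  constructor <;> linarith

theorem continuousOn_cayley (b : ℝ) :
    ContinuousOn (fun x : ℝ => (1 - x) / (1 + x)) (Set.Icc 0 b) :=
  ContinuousOn.div (by fun_prop) (by fun_prop) fun x hx => by linarith [hx.1]

theorem log_one_sub_cayley {x : ℝ} (h0 : 0 < x) :
    log (1 - (1 - x) / (1 + x)) = log 2 + log x - log (1 + x) := by
  rw [← log_mul two_ne_zero h0.ne', ← log_div (by positivity) (by positivity)]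
  congr 1
  field_simp
  ring

theorem log_one_add_cayley {x : ℝ} (h0 : 0 < x) :
    log (1 - -((1 - x) / (1 + x))) = log 2 - log (1 + x) := by
  rw [← log_div (by positivity) (by positivity)]
  congr 1
  field_simp
  ring

theorem polyLog_two_neg_one : polyLog 2 (-1) = -π ^ 2 / 12 := by
  have h := polyLog_add_polyLog_neg (s := 1) le_rfl (x := 1) (by simp)
  norm_num [polyLog_two_one] at h
  linarith

theorem polyLog_three_neg_one : polyLog 3 (-1) = -(3 / 4) * polyLog 3 1 := by
  have h := polyLog_add_polyLog_neg (s := 2) (by norm_num) (x := 1) (by simp)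
  norm_num at h
  linarith

/-- Twice the functional equation of Legendre's chi function under `x ↦ (1 - x) / (1 + x)`. The
constant is `Li₂(1) - Li₂(-1)`, the value at 0. -/
theorem polyLog_two_cayley {b : ℝ} (h0 : 0 < b) (h1 : b < 1) :
    polyLog 2 ((1 - b) / (1 + b)) - polyLog 2 (-((1 - b) / (1 + b)))
      + polyLog 2 b - polyLog 2 (-b) = π ^ 2 / 4 + log b * log (1 + b) - log b * log (1 - b) := by
  have key := eq_of_hasDerivAt_zero
    (f := fun x => polyLog 2 ((1 - x) / (1 + x)) - polyLog 2 (-((1 - x) / (1 + x)))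
      + polyLog 2 x - polyLog 2 (-x) - log x * log (1 + x) + log x * log (1 - x)) h0 ?_ ?_
  · simp [polyLog_two_one, polyLog_two_neg_one] at key
    linarith
  · refine ContinuousOn.add (.sub (.sub (.add (.sub ?_ ?_) ?_) ?_)
      (continuousOn_log_mul_log_one_add' b)) (continuousOn_log_mul_log_one_sub h1)
    · exact (continuousOn_cayley b).polyLog le_rfl fun x hx =>
        ⟨by linarith [(cayley_bounds hx.1 (hx.2.trans h1.le)).1],
          (cayley_bounds hx.1 (hx.2.trans h1.le)).2⟩
    · exact (continuousOn_cayley b).neg.polyLog le_rfl fun x hx =>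
        ⟨neg_le_neg (cayley_bounds hx.1 (hx.2.trans h1.le)).2,
          by
            have := (cayley_bounds hx.1 (hx.2.trans h1.le)).1
            simp only [Pi.neg_apply]
            linarith⟩
    · exact continuousOn_id.polyLog le_rfl fun x hx =>
        ⟨by simp; linarith [hx.1], by simp; linarith [hx.2]⟩
    · exact continuousOn_id.neg.polyLog le_rfl fun x hx => ⟨by simp; linarith [hx.2], by simp; linarith [hx.1]⟩
  · rintro x ⟨hx0, hxb⟩
    have hx1 : x < 1 := hxb.trans h1
    have hs : 1 - x ≠ 0 := by linarith
    have ha : 1 + x ≠ 0 := by linarith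
    have hc := cayley_bounds' hx0 hx1
    have d1 := (hasDerivAt_cayley ha).polyLog 1 (by linarith) hc.2 hc.1.ne'
    have d2 := (hasDerivAt_neg_cayley ha).polyLog 1 (by linarith) (by linarith)
      (neg_ne_zero.mpr hc.1.ne')
    have d3 := (hasDerivAt_id x).polyLog 1 (by simp; linarith) (by simpa) (by simpa using hx0.ne')
    have d4 := (hasDerivAt_neg x).polyLog 1 (by linarith) (by linarith) (neg_ne_zero.mpr hx0.ne')
    have d5 := (hasDerivAt_log hx0.ne').mul ((hasDerivAt_one_add x).log ha)
    have d6 := (hasDerivAt_log hx0.ne').mul ((hasDerivAt_one_sub x).log hs)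
    refine (((((d1.sub d2).add d3).sub d4).sub d5).add d6).congr_deriv ?_
    simp only [id]
    rw [polyLog_one_left (by linarith) hc.2, polyLog_one_left (by linarith) (by linarith),
      polyLog_one_left (by linarith) hx1, polyLog_one_left (by linarith) (by linarith),
      log_one_sub_cayley hx0, log_one_add_cayley hx0, sub_neg_eq_add]
    field_simp
    ring

/-! ### Functional equations of the trilogarithm -/

/-- Landen's identity for the trilogarithm. -/
theorem polyLog_three_landen {b : ℝ} (h0 : 0 < b) (h1 : b ≤ 1 / 2) :
    polyLog 3 (1 - b) + polyLog 3 b + polyLog 3 (-b / (1 - b)) =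
      polyLog 3 1 + log (1 - b) ^ 3 / 6 + π ^ 2 / 6 * log (1 - b)
        - log (1 - b) ^ 2 * log b / 2 := by
  have hb : b < 1 := by linarith
  -- The last term is grouped around `log x * log (1 - x)`, which is continuous at 0 although `log
  -- x` is not.
  have key := eq_of_hasDerivAt_zero
    (f := fun x => polyLog 3 (1 - x) + polyLog 3 x + polyLog 3 (-x / (1 - x))
      - log (1 - x) ^ 3 / 6 - π ^ 2 / 6 * log (1 - x)
      + log (1 - x) * (log x * log (1 - x)) / 2) h0 ?_ ?_
  · simp at key
    linarith
  · have hl := continuousOn_log_one_sub hb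
    refine ContinuousOn.add (.sub (.sub (.add (.add ?_ ?_) ?_) ((hl.pow 3).div_const 6))
      (hl.const_mul _)) ((hl.mul (continuousOn_log_mul_log_one_sub hb)).div_const 2)
    · exact ContinuousOn.polyLog (by norm_num) (by fun_prop) fun x hx =>
        ⟨by linarith [hx.2], by linarith [hx.1]⟩
    · exact continuousOn_id.polyLog (by norm_num) fun x hx =>
        ⟨by simp; linarith [hx.1], by simp; linarith [hx.2]⟩
    · exact (continuousOn_neg_div_one_sub hb).polyLog (by norm_num) fun x hx =>
        neg_div_one_sub_bounds (hx.2.trans h1)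
  · rintro x ⟨hx0, hxb⟩
    have hx1 : 0 < 1 - x := by linarith
    have hs := neg_div_one_sub_bounds' hx0 (hxb.trans_le h1)
    have d1 := (hasDerivAt_one_sub x).polyLog 2 (by linarith) (by linarith) hx1.ne'
    have d2 := (hasDerivAt_id x).polyLog 2 (by simp; linarith) (by simp; linarith)
      (by simpa using hx0.ne')
    have d3 := (hasDerivAt_neg_div_one_sub hx1.ne').polyLog 2 hs.1 (by linarith) hs.2.ne
    have l := (hasDerivAt_one_sub x).log hx1.ne'
    have d6 := (l.mul ((hasDerivAt_log hx0.ne').mul l)).div_const 2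
    refine (((((d1.add d2).add d3).sub ((l.pow 3).div_const 6)).sub
      (l.const_mul (π ^ 2 / 6))).add d6).congr_deriv ?_
    -- Reflection and Landen express the dilogarithms in the derivative through `Li₂(x)`, which then
    -- cancels.
    have e1 : polyLog 2 (1 - x) = π ^ 2 / 6 - log x * log (1 - x) - polyLog 2 x := by
      linarith [polyLog_two_add_one_sub hx0 (by linarith)]
    have e2 : polyLog 2 (-x / (1 - x)) = - log (1 - x) ^ 2 / 2 - polyLog 2 x := by
      linarith [polyLog_two_landen hx0 (by linarith)]
    simp only [id, Pi.mul_apply]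
    rw [e1, e2]
    field_simp
    ring

/-- A special case of Spence's functional equation of the trilogarithm. -/
theorem polyLog_three_spence {b : ℝ} (h0 : 0 < b) (h1 : b ≤ 1) :
    polyLog 3 ((1 - b) / (1 + b)) - polyLog 3 (-((1 - b) / (1 + b))) =
      2 * polyLog 3 (1 - b) + 2 * polyLog 3 (1 / (1 + b)) - polyLog 3 (1 - b ^ 2) / 2
        - 7 / 4 * polyLog 3 1 + π ^ 2 / 6 * log (1 + b) - log (1 + b) ^ 3 / 3 := by
  have key := eq_of_hasDerivAt_zero
    (f := fun x => polyLog 3 ((1 - x) / (1 + x)) - polyLog 3 (-((1 - x) / (1 + x)))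
      - 2 * polyLog 3 (1 - x) - 2 * polyLog 3 (1 / (1 + x)) + polyLog 3 (1 - x ^ 2) / 2
      - π ^ 2 / 6 * log (1 + x) + log (1 + x) ^ 3 / 3) h0 ?_ ?_
  · simp [polyLog_three_neg_one] at key
    simp only [one_div]
    linarith
  · have hl : ContinuousOn (fun x : ℝ => log (1 + x)) (Set.Icc 0 b) :=
      ContinuousOn.log (by fun_prop) fun x hx => by linarith [hx.1]
    have hc {x : ℝ} (hx : x ∈ Set.Icc 0 b) := cayley_bounds hx.1 (hx.2.trans h1)
    refine ContinuousOn.add (.sub (.add (.sub (.sub (.sub ?_ ?_) (.const_mul ?_ _))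
      (.const_mul ?_ _)) (.div_const ?_ _)) (hl.const_mul _)) ((hl.pow 3).div_const 3)
    · exact (continuousOn_cayley b).polyLog (by norm_num) fun x hx =>
        ⟨by linarith [(hc hx).1], (hc hx).2⟩
    · exact (continuousOn_cayley b).neg.polyLog (by norm_num) fun x hx =>
        ⟨neg_le_neg (hc hx).2, by
          have := (hc hx).1
          simp only [Pi.neg_apply]
          linarith⟩
    · exact ContinuousOn.polyLog (by norm_num) (by fun_prop) fun x hx =>
        ⟨by linarith [hx.2], by linarith [hx.1]⟩
    · refine ContinuousOn.polyLog (by norm_num) (ContinuousOn.div (by fun_prop) (by fun_prop)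
        fun x hx => by linarith [hx.1]) fun x hx => ?_
      have : 0 < 1 + x := by linarith [hx.1]
      rw [le_div_iff₀ this, div_le_iff₀ this]
      constructor <;> linarith [hx.1]
    · exact ContinuousOn.polyLog (by norm_num) (by fun_prop) fun x hx =>
        ⟨by nlinarith [hx.1, hx.2], by nlinarith [hx.1]⟩
  · rintro x ⟨hx0, hxb⟩
    have hx1 : x < 1 := by linarith
    have hs : 1 - x ≠ 0 := by linarith
    have ha : 0 < 1 + x := by linarith
    have hc := cayley_bounds' hx0 hx1
    have hq : 1 - x ^ 2 ≠ 0 := by nlinarith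
    have hi : 0 < 1 / (1 + x) ∧ 1 / (1 + x) < 1 := by
      rw [div_lt_iff₀ ha]
      exact ⟨by positivity, by linarith⟩
    have hy : 0 < x / (1 + x) ∧ x / (1 + x) ≤ 1 / 2 := by
      rw [div_le_iff₀ ha]
      exact ⟨by positivity, by linarith⟩
    have d1 := (hasDerivAt_cayley ha.ne').polyLog 2 (by linarith) hc.2 hc.1.ne'
    have d2 := (hasDerivAt_neg_cayley ha.ne').polyLog 2 (by linarith) (by linarith)
      (neg_ne_zero.mpr hc.1.ne')
    have d3 := ((hasDerivAt_one_sub x).polyLog 2 (by linarith) (by linarith) hs).const_mul 2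
    have d4 := (((hasDerivAt_const x (1 : ℝ)).div (hasDerivAt_one_add x) ha.ne').polyLog 2
      (by simp only [Pi.div_apply]; linarith) hi.2 hi.1.ne').const_mul 2
    have d5 := ((((hasDerivAt_id x).pow 2).const_sub 1).polyLog 2 (by simp; nlinarith)
      (by simp; nlinarith) (by simpa using hq)).div_const 2
    have l := (hasDerivAt_one_add x).log ha.ne'
    refine ((((((d1.sub d2).sub d3).sub d4).add d5).sub (l.const_mul (π ^ 2 / 6))).add
      ((l.pow 3).div_const 3)).congr_deriv ?_
    have e0 : log (1 - x ^ 2) = log (1 - x) + log (1 + x) := by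
      rw [← log_mul hs ha.ne']
      ring_nf
    -- All dilogarithms in the derivative are reduced to those at `x`, `-x` and `-(1 - x) / (1 +
    -- x)`, which cancel.
    have e1 : polyLog 2 (1 - x) = π ^ 2 / 6 - log x * log (1 - x) - polyLog 2 x := by
      linarith [polyLog_two_add_one_sub hx0 hx1]
    have e2 : polyLog 2 (1 - x ^ 2) = π ^ 2 / 6 - 2 * log x * (log (1 - x) + log (1 + x))
        - 2 * (polyLog 2 x + polyLog 2 (-x)) := by
      have := polyLog_two_add_one_sub (b := x ^ 2) (by positivity) (by nlinarith)
      rw [e0, log_pow] at this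
      have h2 := polyLog_add_polyLog_neg (s := 1) le_rfl (x := x) (abs_le.mpr ⟨by linarith, hx1.le⟩)
      norm_num at h2 this
      linarith
    -- Landen and reflection at `y = x / (1 + x)`, for which `1 - y = 1 / (1 + x)` and `-y / (1 - y)
    -- = -x`.
    have e3 : polyLog 2 (1 / (1 + x)) = π ^ 2 / 6 + log (1 + x) * (log x - log (1 + x))
        + log (1 + x) ^ 2 / 2 + polyLog 2 (-x) := by
      have h3 := polyLog_two_landen hy.1 hy.2
      have h4 := polyLog_two_add_one_sub hy.1 (by linarith [hy.2])
      have h5 : 1 - x / (1 + x) = 1 / (1 + x) := by field_simp; ring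
      have h6 : -(x / (1 + x)) / (1 / (1 + x)) = -x := by field_simp
      rw [h5] at h3 h4
      rw [h6, one_div, log_inv] at h3
      rw [one_div, log_inv, log_div hx0.ne' ha.ne'] at h4
      rw [one_div]
      linarith
    have e4 : polyLog 2 ((1 - x) / (1 + x)) = polyLog 2 (-((1 - x) / (1 + x)))
        - polyLog 2 x + polyLog 2 (-x) + π ^ 2 / 4 + log x * log (1 + x) - log x * log (1 - x) := by
      linarith [polyLog_two_cayley hx0 hx1]
    simp only [id, Pi.div_apply, Pi.pow_apply, e1, e2, e3, e4]
    have hq' : 1 - x ^ 2 = (1 - x) * (1 + x) := by ring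
    rw [hq']
    field_simp
    ring

/-! ### P-polynomials as coefficients of powers of `sinh t / t - 1` -/

/-- The power series whose value at `t ^ 2` is `sinh t / t - 1`. -/
noncomputable def sinhcSeries : PowerSeries ℝ :=
  .mk fun n => if n = 0 then 0 else 1 / ((2 * n + 1).factorial : ℝ)

/-- The power series whose value at `t ^ 2` is `cosh t - 1`. -/
noncomputable def coshSeries : PowerSeries ℝ :=
  .mk fun n => if n = 0 then 0 else 1 / ((2 * n).factorial : ℝ)

theorem coeff_X_mul_derivative (f : PowerSeries ℝ) (n : ℕ) :
    PowerSeries.coeff n (PowerSeries.X * PowerSeries.derivative ℝ f) = n * PowerSeries.coeff n f := by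
  cases n with
  | zero => simp
  | succ n => rw [PowerSeries.coeff_succ_X_mul, PowerSeries.coeff_derivative]; push_cast; ring

/-- This is `cosh t = (t * (sinh t / t))'` in the variable `T = t ^ 2`, where `t d/dt = 2 T d/dT`.
-/
theorem coshSeries_eq :
    coshSeries = 2 * (PowerSeries.X * PowerSeries.derivative ℝ sinhcSeries) + sinhcSeries := by
  ext n
  have h2 : (2 : PowerSeries ℝ) = PowerSeries.C 2 := (map_ofNat _ 2).symm
  rw [map_add, h2, PowerSeries.coeff_C_mul, coeff_X_mul_derivative]
  simp only [coshSeries, sinhcSeries, PowerSeries.coeff_mk]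
  split_ifs with h
  · simp
  · rw [Nat.factorial_succ]
    push_cast
    have : (2 * (n : ℝ) + 1) ≠ 0 := by positivity
    field_simp

/-- Apply `2 T d/dT + (l + 1)` to `v ^ (l + 1)`: the Leibniz rule yields `(l + 1) v ^ l (2 T v' +
v)`, and the bracket is `cosh t - 1`. -/
theorem coeff_sinhcSeries_pow_succ (l n : ℕ) :
    (2 * n + (l + 1) : ℝ) * PowerSeries.coeff n (sinhcSeries ^ (l + 1)) =
      (l + 1) * PowerSeries.coeff n (sinhcSeries ^ l * coshSeries) := by
  have h2 : (2 : PowerSeries ℝ) = PowerSeries.C 2 := (map_ofNat _ 2).symm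
  have h1 : ((l : PowerSeries ℝ) + 1) = PowerSeries.C (l + 1 : ℝ) := by simp
  have h : 2 * (PowerSeries.X * PowerSeries.derivative ℝ (sinhcSeries ^ (l + 1))) + ((l : PowerSeries ℝ) + 1) *
      sinhcSeries ^ (l + 1) = ((l : PowerSeries ℝ) + 1) * (sinhcSeries ^ l * coshSeries) := by
    rw [coshSeries_eq, Derivation.leibniz_pow]
    simp only [Nat.add_sub_cancel, smul_eq_mul, nsmul_eq_mul]
    push_cast
    ring
  have := congrArg (PowerSeries.coeff n) h
  rw [map_add, h2, h1, PowerSeries.coeff_C_mul, PowerSeries.coeff_C_mul, PowerSeries.coeff_C_mul, coeff_X_mul_derivative] at this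
  linarith

theorem coeff_sinhcSeries_pow_of_lt {m n : ℕ} (h : n < m) : PowerSeries.coeff n (sinhcSeries ^ m) = 0 := by
  have hX : (PowerSeries.X : PowerSeries ℝ) ∣ sinhcSeries := by
    rw [PowerSeries.X_dvd_iff, ← PowerSeries.coeff_zero_eq_constantCoeff_apply]
    simp [sinhcSeries]
  exact PowerSeries.X_pow_dvd_iff.mp (pow_dvd_pow_of_dvd hX m) n h

/-- The sum in the recursion is the Cauchy product of `v ^ (l + 1)` with `cosh t - 1`. Its range is
right because `T ^ (l + 1)` divides the first factor and the second has no constant term. -/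
theorem pDiag_eq_coeff (m n : ℕ) (h : m + 1 ≤ n) :
    pDiag (m + 1) n = 6 ^ n / (m + 1) * PowerSeries.coeff n (sinhcSeries ^ (m + 1)) := by
  induction m generalizing n with
  | zero =>
    have : n ≠ 0 := by omega
    simp [pDiag, sinhcSeries, this]
    ring
  | succ l ih =>
    have hsum : ∑ i ∈ Finset.Ico (l + 1) n,
        pDiag (l + 1) i / (6 ^ i * ((2 * n - 2 * i).factorial : ℝ)) =
        PowerSeries.coeff n (sinhcSeries ^ (l + 1) * coshSeries) / (l + 1) := by
      rw [PowerSeries.coeff_mul, Finset.Nat.sum_antidiagonal_eq_sum_range_succ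
        (fun i j => PowerSeries.coeff i (sinhcSeries ^ (l + 1)) * PowerSeries.coeff j coshSeries),
        Finset.sum_range_succ, Finset.range_eq_Ico, ← Finset.sum_Ico_consecutive _
        (Nat.zero_le (l + 1)) (by omega : l + 1 ≤ n), Finset.sum_eq_zero (s := Finset.Ico 0 (l + 1))]
      · simp only [coshSeries, PowerSeries.coeff_mk, Nat.sub_self, if_true, mul_zero, add_zero,
          zero_add]
        rw [Finset.sum_div]
        refine Finset.sum_congr rfl fun i hi => ?_
        obtain ⟨h1, h2⟩ := Finset.mem_Ico.mp hi
        rw [ih i h1, if_neg (by omega), Nat.mul_sub]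
        field_simp
      · intro i hi
        rw [coeff_sinhcSeries_pow_of_lt (Finset.mem_Ico.mp hi).2, zero_mul]
    have hc := coeff_sinhcSeries_pow_succ (l + 1) n
    rw [pDiag, hsum]
    push_cast at hc ⊢
    have h1 : (2 * n + (l + 2) : ℝ) ≠ 0 := by positivity
    have h2 : (l : ℝ) + 1 ≠ 0 := by positivity
    have h3 : (l : ℝ) + 1 + 1 ≠ 0 := by positivity
    field_simp
    linear_combination -hc

theorem coeff_sinhcSeries_nonneg (n : ℕ) : 0 ≤ PowerSeries.coeff n sinhcSeries := by
  rw [sinhcSeries, PowerSeries.coeff_mk]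
  split_ifs <;> positivity

theorem coeff_sinhcSeries_pow_nonneg (m n : ℕ) :
    0 ≤ PowerSeries.coeff n (sinhcSeries ^ m) := by
  induction m generalizing n with
  | zero =>
    rw [pow_zero, PowerSeries.coeff_one]
    split_ifs <;> norm_num
  | succ m ih =>
    rw [pow_succ, PowerSeries.coeff_mul]
    exact Finset.sum_nonneg fun p _ => mul_nonneg (ih _) (coeff_sinhcSeries_nonneg _)

/-! ### Expansion of `1 - (t / sinh t) ^ 2` -/

/-- The function `sinh t / t - 1`. -/
noncomputable def sinhcSubOne (t : ℝ) : ℝ := sinh t / t - 1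

theorem hasSum_sinhcSeries {t : ℝ} (ht : t ≠ 0) :
    HasSum (fun n => PowerSeries.coeff n sinhcSeries * (t ^ 2) ^ n) (sinhcSubOne t) := by
  have h := ((Real.hasSum_sinh t).div_const t).update 0 0
  have h' : 0 - t ^ (2 * 0 + 1) / ((2 * 0 + 1).factorial : ℝ) / t + sinh t / t =
      sinhcSubOne t := by
    simp [sinhcSubOne, ht]
    ring
  rw [h'] at h
  convert! h using 2 with n
  · rcases eq_or_ne n 0 with rfl | hn
    · simp [sinhcSeries]
    · simp only [sinhcSeries, PowerSeries.coeff_mk, hn, if_false, Function.update_of_ne, ne_eq,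
        not_false_eq_true]
      rw [← pow_mul]
      field_simp
      ring

theorem hasSum_sinhcSeries_pow {t : ℝ} (ht : t ≠ 0) (m : ℕ) :
    HasSum (fun n => PowerSeries.coeff n (sinhcSeries ^ m) * (t ^ 2) ^ n) (sinhcSubOne t ^ m) := by
  induction m with
  | zero =>
    convert! hasSum_ite_eq (0 : ℕ) (1 : ℝ) using 2 with n
    rw [pow_zero, PowerSeries.coeff_one]
    split_ifs with h <;> simp [h]
  | succ m ih =>
    have h1 := hasSum_sinhcSeries ht
    have n0 : Summable fun n => ‖PowerSeries.coeff n (sinhcSeries ^ m) * (t ^ 2) ^ n‖ :=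
      ih.summable.norm
    have n1 : Summable fun n => ‖PowerSeries.coeff n sinhcSeries * (t ^ 2) ^ n‖ :=
      h1.summable.norm
    have e := tsum_mul_tsum_eq_tsum_sum_antidiagonal_of_summable_norm n0 n1
    have s := (summable_norm_sum_mul_antidiagonal_of_summable_norm n0 n1).of_norm
    rw [ih.tsum_eq, h1.tsum_eq, ← pow_succ] at e
    rw [e]
    convert! s.hasSum using 2 with n
    rw [pow_succ, PowerSeries.coeff_mul, Finset.sum_mul]
    refine Finset.sum_congr rfl fun p hp => ?_
    rw [← Finset.HasAntidiagonal.mem_antidiagonal.mp hp, pow_add]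
    ring

theorem sinhcSubOne_nonneg {t : ℝ} (ht : 0 < t) : 0 ≤ sinhcSubOne t := by
  rw [sinhcSubOne, sub_nonneg, le_div_iff₀ ht, one_mul]
  exact self_le_sinh_iff.mpr ht.le

/-- Nonnegative coefficients make `v` increasing, and at `t = 1` it is `sinh 1 - 1 < 1`. -/
theorem sinhcSubOne_lt_one {t : ℝ} (ht : 0 < t) (h1 : t ≤ 1) : sinhcSubOne t < 1 := by
  have h : sinhcSubOne t ≤ sinhcSubOne 1 :=
    hasSum_le (fun n => mul_le_mul_of_nonneg_left
      (pow_le_pow_left₀ (by positivity) (pow_le_pow_left₀ ht.le h1 2) n)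
      (coeff_sinhcSeries_nonneg n)) (hasSum_sinhcSeries ht.ne') (hasSum_sinhcSeries one_ne_zero)
  refine h.trans_lt ?_
  rw [sinhcSubOne, sinh_eq]
  linarith [exp_one_lt_d9, exp_pos (-1)]

theorem hasSum_sinhcSeries_pow_shift {t : ℝ} (ht : t ≠ 0) (m : ℕ) :
    HasSum (fun k => PowerSeries.coeff (k + 1) (sinhcSeries ^ (m + 1)) * (t ^ 2) ^ (k + 1))
      (sinhcSubOne t ^ (m + 1)) := by
  simpa [coeff_sinhcSeries_pow_of_lt (Nat.succ_pos m), -PowerSeries.coeff_zero_eq_constantCoeff]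
    using (hasSum_nat_add_iff' 1).mpr (hasSum_sinhcSeries_pow ht (m + 1))

/-- The terms of the expansion of `1 - (t / sinh t) ^ 2` in powers of `sinh t / t - 1` and of
`T = t ^ 2`. -/
noncomputable def doubleTerm (T : ℝ) (p : ℕ × ℕ) : ℝ :=
  (-1) ^ p.1 * (p.1 + 2) * PowerSeries.coeff (p.2 + 1) (sinhcSeries ^ (p.1 + 1)) * T ^ (p.2 + 1)

theorem hasSum_doubleTerm_right {t : ℝ} (ht : t ≠ 0) (m : ℕ) :
    HasSum (fun k => doubleTerm (t ^ 2) (m, k))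
      ((-1) ^ m * (m + 2) * sinhcSubOne t ^ (m + 1)) := by
  simpa only [doubleTerm, mul_assoc] using
    (hasSum_sinhcSeries_pow_shift ht m).mul_left ((-1) ^ m * ((m : ℝ) + 2))

theorem norm_doubleTerm (t : ℝ) (p : ℕ × ℕ) :
    ‖doubleTerm (t ^ 2) p‖ = (p.1 + 2) *
      (PowerSeries.coeff (p.2 + 1) (sinhcSeries ^ (p.1 + 1)) * (t ^ 2) ^ (p.2 + 1)) := by
  have h := coeff_sinhcSeries_pow_nonneg (p.1 + 1) (p.2 + 1)
  rw [doubleTerm, mul_assoc, mul_assoc, norm_mul, norm_pow, norm_neg, norm_one, one_pow, one_mul,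
    Real.norm_of_nonneg (by positivity)]

theorem hasSum_geometric_deriv_shift {v : ℝ} (hv : ‖v‖ < 1) :
    HasSum (fun m : ℕ => ((m : ℝ) + 2) * v ^ (m + 1)) (1 / (1 - v) ^ 2 - 1) := by
  have h : HasSum (fun m : ℕ => ((m : ℝ) + 1) * v ^ m) (1 / (1 - v) ^ 2) := by
    simpa using hasSum_choose_mul_geometric_of_norm_lt_one 1 hv
  have h' := (hasSum_nat_add_iff' 1).mpr h
  simp only [Finset.sum_range_one, pow_zero, Nat.cast_zero, zero_add, mul_one] at h'
  refine h'.congr_fun fun m => ?_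
  push_cast
  ring

theorem norm_sinhcSubOne_lt_one {t : ℝ} (ht : 0 < t) (h1 : t ≤ 1) : ‖sinhcSubOne t‖ < 1 := by
  rw [Real.norm_of_nonneg (sinhcSubOne_nonneg ht)]
  exact sinhcSubOne_lt_one ht h1

/-- The powers of `v` have nonnegative coefficients, so the absolute values sum to `(1 - v) ^ (-2) -
1`, finite since `v < 1`. This justifies every later rearrangement. -/
theorem summable_doubleTerm {t : ℝ} (ht : 0 < t) (h1 : t ≤ 1) :
    Summable (doubleTerm (t ^ 2)) := by
  refine Summable.of_norm ((summable_prod_of_nonneg fun p => norm_nonneg _).mpr ⟨fun m => ?_, ?_⟩)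
  · exact (hasSum_doubleTerm_right ht.ne' m).summable.norm
  · refine (hasSum_geometric_deriv_shift (norm_sinhcSubOne_lt_one ht h1)).summable.congr
      fun m => ?_
    simp only [norm_doubleTerm]
    rw [tsum_mul_left, (hasSum_sinhcSeries_pow_shift ht.ne' m).tsum_eq]

/-- The coefficients of the expansion of `1 - (t / sinh t) ^ 2` in powers of `t ^ 2`. -/
noncomputable def invSinhcCoeff (k : ℕ) : ℝ :=
  ∑' m : ℕ, (-1) ^ m * (m + 2) * PowerSeries.coeff (k + 1) (sinhcSeries ^ (m + 1))

theorem tsum_doubleTerm_left (T : ℝ) (k : ℕ) :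
    ∑' m, doubleTerm T (m, k) = invSinhcCoeff k * T ^ (k + 1) := by
  simp only [doubleTerm, invSinhcCoeff, tsum_mul_right]

theorem hasSum_invSinhcCoeff {t : ℝ} (ht : 0 < t) (h1 : t ≤ 1) :
    HasSum (fun k => invSinhcCoeff k * (t ^ 2) ^ (k + 1)) (1 - (t / sinh t) ^ 2) := by
  have hs := summable_doubleTerm ht h1
  have h := hs.prod_symm.prod
  simp only [Prod.swap_prod_mk, tsum_doubleTerm_left] at h
  convert! h.hasSum using 1
  rw [← tsum_congr fun k => tsum_doubleTerm_left (t ^ 2) k, Summable.tsum_comm (f := fun m k => doubleTerm (t ^ 2) (m, k)) hs]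
  simp only [(hasSum_doubleTerm_right ht.ne' _).tsum_eq]
  have hv := hasSum_geometric_deriv_shift (v := -sinhcSubOne t)
    (by rw [norm_neg]; exact norm_sinhcSubOne_lt_one ht h1)
  have hv' : HasSum (fun m : ℕ => (-1) ^ m * ((m : ℝ) + 2) * sinhcSubOne t ^ (m + 1))
      (1 - (t / sinh t) ^ 2) := by
    have h2 : sinh t ≠ 0 := (sinh_pos_iff.mpr ht).ne'
    have h3 : 1 - (t / sinh t) ^ 2 = -(1 / (1 - -sinhcSubOne t) ^ 2 - 1) := by
      have h4 : 1 - -sinhcSubOne t = sinh t / t := by rw [sinhcSubOne]; ring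
      rw [h4]
      field_simp
      ring
    rw [h3]
    refine hv.neg.congr_fun fun m => ?_
    rw [neg_pow]
    ring
  rw [hv'.tsum_eq]

/-- The case `t = 1`; it permits termwise differentiation on the whole open unit interval. -/
theorem summable_abs_invSinhcCoeff : Summable fun k => |invSinhcCoeff k| := by
  simpa using (hasSum_invSinhcCoeff one_pos le_rfl).summable.abs

/-! ### Rearrangement of the double series `S` -/

/-- The denominator that arises from four integrations. -/
def quadDenom (k : ℕ) : ℝ := (2 * k + 1) * (2 * k + 2) * (2 * k + 3) * (2 * k + 4)

theorem one_le_quadDenom (k : ℕ) : 1 ≤ quadDenom k := by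
  have h : (0 : ℝ) ≤ k := k.cast_nonneg
  rw [quadDenom]
  exact one_le_mul_of_one_le_of_one_le (one_le_mul_of_one_le_of_one_le
    (one_le_mul_of_one_le_of_one_le (by linarith) (by linarith)) (by linarith)) (by linarith)

theorem coeffTerm_mul_pow {t : ℝ} (n m : ℕ) :
    coeffTerm (t / √6) (n + 1) (m + 1) * (t / √6) ^ (2 * (n + 1)) =
      doubleTerm (t ^ 2) (m, n + m) / quadDenom (n + m) * (t ^ 2 / 6) := by
  have h1 : m + 1 + (n + 1) - 1 = n + m + 1 := by omega
  have h2 : n + m + 1 + 1 - (n + 1) = m + 1 := by omega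
  have h6 : (t / √6) ^ 2 = t ^ 2 / 6 := by rw [div_pow, sq_sqrt (by norm_num)]
  have hd : (2 * ((m + 1 : ℕ) : ℝ) + 2 * ((n + 1 : ℕ) : ℝ) - 3) *
      (2 * ((m + 1 : ℕ) : ℝ) + 2 * ((n + 1 : ℕ) : ℝ) - 2) *
      (2 * ((m + 1 : ℕ) : ℝ) + 2 * ((n + 1 : ℕ) : ℝ) - 1) *
      (2 * ((m + 1 : ℕ) : ℝ) + 2 * ((n + 1 : ℕ) : ℝ)) = quadDenom (n + m) := by
    rw [quadDenom]
    push_cast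
    ring
  have hq : quadDenom (n + m) ≠ 0 := by linarith [one_le_quadDenom (n + m)]
  have hm : (m : ℝ) + 1 ≠ 0 := by positivity
  rw [coeffTerm, hd, pPoly, h1, h2, pDiag_eq_coeff m _ (by omega), pow_mul, pow_mul, h6, doubleTerm]
  simp only [div_pow]
  push_cast
  field_simp
  ring

theorem diagonal_injective : Function.Injective fun p : ℕ × ℕ => (p.2, p.1 + p.2) := by
  rintro ⟨a, b⟩ ⟨c, d⟩ h
  simp only [Prod.mk.injEq] at h ⊢
  omega

theorem summable_doubleTerm_div {t : ℝ} (ht : 0 < t) (h1 : t ≤ 1) :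
    Summable fun p : ℕ × ℕ => doubleTerm (t ^ 2) p / quadDenom p.2 * (t ^ 2 / 6) := by
  refine Summable.mul_right _ (Summable.of_norm_bounded (summable_doubleTerm ht h1).norm fun p => ?_)
  have := one_le_quadDenom p.2
  rw [norm_div, Real.norm_of_nonneg (by linarith : 0 ≤ quadDenom p.2)]
  exact div_le_self (norm_nonneg _) this

theorem summable_coeffTerm_mul_pow {t : ℝ} (ht : 0 < t) (h1 : t ≤ 1) :
    Summable fun p : ℕ × ℕ =>
      coeffTerm (t / √6) (p.1 + 1) (p.2 + 1) * (t / √6) ^ (2 * (p.1 + 1)) := by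
  simp only [coeffTerm_mul_pow]
  exact (summable_doubleTerm_div ht h1).comp_injective diagonal_injective

theorem pSeriesConverges_div_sqrt {t : ℝ} (ht : 0 < t) (h1 : t ≤ 1) :
    PSeriesConverges (t / √6) := by
  have hs := summable_coeffTerm_mul_pow ht h1
  refine ⟨fun n => ?_, ?_⟩
  · have h0 : (t / √6) ^ (2 * (n + 1)) ≠ 0 := by positivity
    exact (summable_mul_right_iff h0).mp (hs.prod_factor n)
  · simpa only [coeff, tsum_mul_right] using hs.prod

theorem pSeries_div_sqrt {t : ℝ} (ht : 0 < t) (h1 : t ≤ 1) :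
    6 * pSeries (t / √6) = ∑' k, invSinhcCoeff k / quadDenom k * t ^ (2 * k + 4) := by
  have hs := summable_coeffTerm_mul_pow ht h1
  have hd := summable_doubleTerm_div ht h1
  have e1 : pSeries (t / √6) = ∑' p : ℕ × ℕ,
      coeffTerm (t / √6) (p.1 + 1) (p.2 + 1) * (t / √6) ^ (2 * (p.1 + 1)) := by
    rw [hs.tsum_prod]
    simp only [pSeries, coeff, tsum_mul_right]
  have e2 : ∑' p : ℕ × ℕ, doubleTerm (t ^ 2) p / quadDenom p.2 * (t ^ 2 / 6) =
      ∑' k, invSinhcCoeff k * (t ^ 2) ^ (k + 1) / quadDenom k * (t ^ 2 / 6) := by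
    rw [hd.tsum_prod, ← hd.tsum_comm]
    simp only [tsum_mul_right, tsum_div_const, tsum_doubleTerm_left]
  have e3 : ∑' p : ℕ × ℕ, doubleTerm (t ^ 2) p / quadDenom p.2 * (t ^ 2 / 6) =
      ∑' p : ℕ × ℕ,
        doubleTerm (t ^ 2) (p.2, p.1 + p.2) / quadDenom (p.1 + p.2) * (t ^ 2 / 6) := by
    -- The map `(n, m) ↦ (m, n + m)` misses only the pairs `(m, k)` with `k < m`, where the
    -- coefficient of `T ^ (k + 1)` in `v ^ (m + 1)` vanishes.
    refine (diagonal_injective.tsum_eq ?_).symm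
    rintro ⟨m, k⟩ hp
    rcases le_or_gt m k with h | h
    · exact ⟨(k - m, m), by simp [h]⟩
    · exact absurd (by simp [doubleTerm, coeff_sinhcSeries_pow_of_lt (Nat.succ_lt_succ h)]) hp
  simp only [coeffTerm_mul_pow] at e1
  rw [e1, ← e3, e2, ← tsum_mul_left]
  refine tsum_congr fun k => ?_
  rw [← pow_mul]
  ring

/-! ### Relations between special values of the trilogarithm -/

theorem polyLog_three_half :
    2 * polyLog 3 (1 / 2) = 7 / 4 * polyLog 3 1 - π ^ 2 / 6 * log 2 + log 2 ^ 3 / 3 := by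
  have h := polyLog_three_spence one_pos le_rfl
  norm_num at h
  norm_num
  linarith

/-- Six relations in the five unwanted values at 1/2, -1/2, 1/3, -1/3 and 1/4; eliminating these
leaves one relation at 2/3, 3/4 and 8/9. -/
theorem six_mul_polyLog_three_two_thirds :
    72 * polyLog 3 (2 / 3) + 36 * polyLog 3 (3 / 4) - 12 * polyLog 3 (8 / 9) = 91 * polyLog 3 1
      - 6 * π ^ 2 * log 2 + 28 * log 2 ^ 3 - 4 * log 3 ^ 3 - 4 * log (3 / 2) ^ 3
      + 8 * log (4 / 3) ^ 3 - 24 * log (4 / 3) * log 2 ^ 2 + 12 * log 3 * log (3 / 2) ^ 2 := by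
  have h1 := polyLog_three_landen (b := 1 / 3) (by norm_num) (by norm_num)
  have h2 := polyLog_three_landen (b := 1 / 4) (by norm_num) (by norm_num)
  have h3 := polyLog_add_polyLog_neg (s := 2) (by norm_num) (x := 1 / 2) (by norm_num [abs_le])
  have h4 := polyLog_three_spence (b := 1 / 2) (by norm_num) (by norm_num)
  have h5 := polyLog_three_spence (b := 1 / 3) (by norm_num) (by norm_num)
  have h6 := polyLog_three_half
  norm_num at h1 h2 h3 h4 h5 h6
  have l4 : log 4 = 2 * log 2 := by
    rw [show (4 : ℝ) = 2 ^ 2 by norm_num, log_pow]; norm_num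
  rw [log_div two_ne_zero three_ne_zero, log_div one_ne_zero three_ne_zero, log_one] at h1
  rw [log_div three_ne_zero four_ne_zero, log_div one_ne_zero four_ne_zero, log_one, l4] at h2
  rw [log_div three_ne_zero two_ne_zero] at h4
  rw [log_div four_ne_zero three_ne_zero, l4] at h5
  rw [log_div four_ne_zero three_ne_zero, l4, log_div three_ne_zero two_ne_zero]
  linarith

/-- The relation between values of the trilogarithm behind the formula for `ζ(3)`. -/
theorem polyLog_three_ladder {s : ℝ} (hs : 0 < s) (h2 : s ^ 2 = 2 / 3) :
    36 * polyLog 3 (3 / 4) - 12 * polyLog 3 (8 / 9) + 576 * polyLog 3 s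
      - 576 * polyLog 3 (2 * s / (1 + s)) - 576 * polyLog 3 ((1 + s) / 2)
      + 144 * polyLog 3 (4 * s / (1 + s) ^ 2) = -413 * polyLog 3 1
      + 48 * π ^ 2 * log (2 / (1 + s)) - 96 * log (2 / (1 + s)) ^ 3
      - 6 * π ^ 2 * log 2 + 28 * log 2 ^ 3 - 4 * log 3 ^ 3 - 4 * log (3 / 2) ^ 3
      + 8 * log (4 / 3) ^ 3 - 24 * log (4 / 3) * log 2 ^ 2 + 12 * log 3 * log (3 / 2) ^ 2 := by
  have hs1 : s < 1 := by nlinarith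
  have hq := cayley_bounds' hs hs1
  have ha : 1 + s ≠ 0 := by positivity
  -- Since `x ↦ (1 - x) / (1 + x)` is an involution, the left side of Spence's identity becomes
  -- `Li₃(s) - Li₃(-s)`.
  have h := polyLog_three_spence hq.1 hq.2.le
  have e1 : (1 - (1 - s) / (1 + s)) / (1 + (1 - s) / (1 + s)) = s := by field_simp; ring
  have e2 : 1 - (1 - s) / (1 + s) = 2 * s / (1 + s) := by field_simp; ring
  have e3 : 1 / (1 + (1 - s) / (1 + s)) = (1 + s) / 2 := by field_simp; ring
  have e4 : 1 - ((1 - s) / (1 + s)) ^ 2 = 4 * s / (1 + s) ^ 2 := by field_simp; ring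
  have e5 : 1 + (1 - s) / (1 + s) = 2 / (1 + s) := by field_simp; ring
  rw [e1, e2, e3, e4, e5] at h
  -- Duplication removes `Li₃(-s)` at the cost of `Li₃(s ^ 2) = Li₃(2/3)`, which the previous
  -- relation eliminates.
  have hd := polyLog_add_polyLog_neg (s := 2) (by norm_num) (x := s)
    (abs_le.mpr ⟨by linarith, hs1.le⟩)
  rw [h2] at hd
  norm_num at hd
  linarith [six_mul_polyLog_three_two_thirds]

/-! ### Four integrations of `1 / t ^ 2 - 1 / sinh t ^ 2` -/

/-- The coefficients of the `j`-fold integral of `∑ k, invSinhcCoeff k * t ^ (2 * k)`. -/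
noncomputable def integralCoeff : ℕ → ℕ → ℝ
  | 0, k => invSinhcCoeff k
  | j + 1, k => integralCoeff j k / (((2 * k + j : ℕ) : ℝ) + 1)

/-- The `j`-fold integral of `∑ k, invSinhcCoeff k * t ^ (2 * k)`. -/
noncomputable def invSinhcIntegral (j : ℕ) (t : ℝ) : ℝ :=
  ∑' k, integralCoeff j k * t ^ (2 * k + j)

theorem abs_integralCoeff_le (j k : ℕ) : |integralCoeff j k| ≤ |invSinhcCoeff k| := by
  induction j with
  | zero => rfl
  | succ j ih =>
    rw [integralCoeff, abs_div, abs_of_nonneg (by positivity : 0 ≤ ((2 * k + j : ℕ) : ℝ) + 1)]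
    exact (div_le_self (abs_nonneg _) (by linarith [(2 * k + j).cast_nonneg (α := ℝ)])).trans ih

theorem hasDerivAt_invSinhcIntegral (j : ℕ) {t : ℝ} (ht : |t| < 1) :
    HasDerivAt (invSinhcIntegral (j + 1)) (invSinhcIntegral j t) t := by
  have hs : Summable fun k => |integralCoeff j k| * 1 ^ (2 * k + j) := by
    simpa using Summable.of_nonneg_of_le (fun k => abs_nonneg _) (abs_integralCoeff_le j)
      summable_abs_invSinhcCoeff
  have h := hasDerivAt_tsum_mul_pow_div (e := fun k => 2 * k + j) hs ht
  have hf : invSinhcIntegral (j + 1) = fun x => ∑' k,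
      integralCoeff j k * x ^ (2 * k + j + 1) / (((2 * k + j : ℕ) : ℝ) + 1) := by
    funext x
    refine tsum_congr fun k => ?_
    rw [integralCoeff, ← add_assoc]
    ring
  rw [hf]
  exact h

theorem invSinhcIntegral_succ_zero (j : ℕ) : invSinhcIntegral (j + 1) 0 = 0 := by
  simp [invSinhcIntegral]

theorem continuousOn_invSinhcIntegral (j : ℕ) {b : ℝ} (hb : b < 1) :
    ContinuousOn (invSinhcIntegral (j + 1)) (Set.Icc 0 b) := fun t ht =>
  (hasDerivAt_invSinhcIntegral j (abs_lt.mpr ⟨by linarith [ht.1], by linarith [ht.2]⟩)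
    ).continuousAt.continuousWithinAt

theorem invSinhcIntegral_zero_left {t : ℝ} (ht : 0 < t) (h1 : t ≤ 1) :
    invSinhcIntegral 0 t = 1 / t ^ 2 - 1 / sinh t ^ 2 := by
  have h := ((hasSum_invSinhcCoeff ht h1).div_const (t ^ 2)).tsum_eq
  have h2 : sinh t ≠ 0 := (sinh_pos_iff.mpr ht).ne'
  have e : (1 - (t / sinh t) ^ 2) / t ^ 2 = 1 / t ^ 2 - 1 / sinh t ^ 2 := by
    field_simp
  rw [← e, ← h]
  refine tsum_congr fun k => ?_
  rw [integralCoeff, add_zero, pow_mul, pow_succ]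
  field_simp
  ring

/-- The lower bound is `sinh t ≤ t cosh t`, from the mean value theorem, and the upper one is `t ≤
sinh t`. Both sides tend to 0 with `t`, which fixes the constant of the first integration. -/
theorem coth_sub_inv_bounds {t : ℝ} (ht : 0 < t) :
    0 ≤ cosh t / sinh t - 1 / t ∧ cosh t / sinh t - 1 / t ≤ (cosh t - 1) / t := by
  have hs : 0 < sinh t := sinh_pos_iff.mpr ht
  have h1 : t ≤ sinh t := self_le_sinh_iff.mpr ht.le
  have h2 : sinh t ≤ t * cosh t := by
    obtain ⟨c, hc, h⟩ := exists_hasDerivAt_eq_slope sinh cosh ht continuous_sinh.continuousOn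
      fun x _ => hasDerivAt_sinh x
    rw [sinh_zero, sub_zero, sub_zero, eq_div_iff ht.ne'] at h
    have : cosh c ≤ cosh t := by
      rw [cosh_le_cosh, abs_of_pos hc.1, abs_of_pos ht]
      exact hc.2.le
    nlinarith
  have e : cosh t / sinh t - 1 / t = (t * cosh t - sinh t) / (t * sinh t) := by
    field_simp
  rw [e]
  refine ⟨div_nonneg (by linarith) (by positivity), ?_⟩
  rw [div_le_div_iff₀ (by positivity) ht]
  have h3 : 0 ≤ cosh t - 1 := by linarith [one_le_cosh t]
  nlinarith [mul_nonneg ht.le (mul_nonneg h3 (sub_nonneg.mpr h1)), mul_nonneg ht.le (sub_nonneg.mpr h1)]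

theorem continuousWithinAt_coth_sub_inv :
    ContinuousWithinAt (fun t => cosh t / sinh t - 1 / t) (Set.Ici 0) 0 := by
  have h : HasDerivAt cosh 0 0 := by simpa using hasDerivAt_cosh 0
  have h1 := h.continuousAt_div.continuousWithinAt (s := Set.Ici 0)
  rw [ContinuousWithinAt, Function.update_self] at h1
  rw [ContinuousWithinAt]
  simp only [sinh_zero, div_zero, sub_zero]
  refine squeeze_zero' ?_ ?_ h1
  all_goals
    filter_upwards [self_mem_nhdsWithin] with t ht
    rcases (Set.mem_Ici.mp ht).eq_or_lt with rfl | h0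
    · simp
  · exact (coth_sub_inv_bounds h0).1
  · simpa [Function.update_of_ne h0.ne'] using (coth_sub_inv_bounds h0).2

theorem invSinhcIntegral_one_left {b : ℝ} (hb : 0 < b) (h1 : b < 1) :
    invSinhcIntegral 1 b = cosh b / sinh b - 1 / b := by
  have key := eq_of_hasDerivAt_zero
    (f := fun t => invSinhcIntegral 1 t - (cosh t / sinh t - 1 / t)) hb ?_ ?_
  · simp [invSinhcIntegral_succ_zero 0] at key
    simp only [one_div]
    linarith
  · refine (continuousOn_invSinhcIntegral 0 h1).sub fun t ht => ?_
    rcases ht.1.eq_or_lt with rfl | h0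
    · exact continuousWithinAt_coth_sub_inv.mono Set.Icc_subset_Ici_self
    · have hs : sinh t ≠ 0 := (sinh_pos_iff.mpr h0).ne'
      have h0' := h0.ne'
      exact ContinuousAt.continuousWithinAt (by fun_prop (disch := assumption))
  · rintro t ⟨h0, htb⟩
    have hs : sinh t ≠ 0 := (sinh_pos_iff.mpr h0).ne'
    have d := (hasDerivAt_invSinhcIntegral 0 (abs_lt.mpr ⟨by linarith, htb.trans h1⟩)).sub
      (((hasDerivAt_cosh t).div (hasDerivAt_sinh t) hs).sub
        ((hasDerivAt_const t (1 : ℝ)).div (hasDerivAt_id t) h0.ne'))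
    refine d.congr_deriv ?_
    rw [invSinhcIntegral_zero_left h0 (htb.trans h1).le]
    simp only [id]
    field_simp
    linear_combination t ^ 2 * cosh_sq t

theorem continuousWithinAt_log_sinh_div :
    ContinuousWithinAt (fun t => log (sinh t / t)) (Set.Ici 0) 0 := by
  have h : HasDerivAt sinh 1 0 := by simpa using hasDerivAt_sinh 0
  have h1 := h.continuousAt_div.log (by simp)
  refine (h1.continuousWithinAt (s := Set.Ici 0)).congr (fun t ht => ?_) (by simp)
  rcases eq_or_ne t 0 with rfl | h0
  · simp
  · simp [Function.update_of_ne h0]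

theorem invSinhcIntegral_two_left {b : ℝ} (hb : 0 < b) (h1 : b < 1) :
    invSinhcIntegral 2 b = log (sinh b / b) := by
  have key := eq_of_hasDerivAt_zero
    (f := fun t => invSinhcIntegral 2 t - log (sinh t / t)) hb ?_ ?_
  · simp [invSinhcIntegral_succ_zero 1] at key
    linarith
  · refine (continuousOn_invSinhcIntegral 1 h1).sub fun t ht => ?_
    rcases ht.1.eq_or_lt with rfl | h0
    · exact continuousWithinAt_log_sinh_div.mono Set.Icc_subset_Ici_self
    · have hs : sinh t / t ≠ 0 := (div_pos (sinh_pos_iff.mpr h0) h0).ne'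
      have h0' := h0.ne'
      exact ContinuousAt.continuousWithinAt (by fun_prop (disch := assumption))
  · rintro t ⟨h0, htb⟩
    have hs : sinh t ≠ 0 := (sinh_pos_iff.mpr h0).ne'
    have d := (hasDerivAt_invSinhcIntegral 1 (abs_lt.mpr ⟨by linarith, htb.trans h1⟩)).sub
      (((hasDerivAt_sinh t).div (hasDerivAt_id t) h0.ne').log (by
        simp only [Pi.div_apply, id]
        exact div_ne_zero hs h0.ne'))
    refine d.congr_deriv ?_
    rw [invSinhcIntegral_one_left h0 (htb.trans h1)]
    simp only [id, Pi.div_apply]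
    field_simp
    ring

theorem exp_neg_two_mul_lt_one {t : ℝ} (ht : 0 < t) : exp (-(2 * t)) < 1 := by
  rw [exp_lt_one_iff]
  linarith

/-- From `sinh t = exp t * (1 - exp (-2 t)) / 2`; the last logarithm is `-Li₁(exp (-2 t))`, so two
more integrations lead to `Li₂` and `Li₃`. -/
theorem log_sinh_div {t : ℝ} (ht : 0 < t) :
    log (sinh t / t) = t - log (2 * t) + log (1 - exp (-(2 * t))) := by
  have h1 := exp_neg_two_mul_lt_one ht
  have h3 : t - log (2 * t) = log (exp t) - log (2 * t) := by rw [log_exp]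
  rw [h3, ← log_div (exp_pos t).ne' (by positivity), ← log_mul (by positivity) (by linarith)]
  congr 1
  have h2 : exp t * exp (-(2 * t)) = exp (-t) := by
    rw [← exp_add]
    ring_nf
  rw [sinh_eq, ← h2]
  generalize exp (-(2 * t)) = q
  field_simp

theorem hasDerivAt_exp_neg_two_mul (t : ℝ) :
    HasDerivAt (fun t => exp (-(2 * t))) (-2 * exp (-(2 * t))) t := by
  have : HasDerivAt (fun t : ℝ => -(2 * t)) (-2) t := by
    simpa only [neg_mul, id, mul_one] using (hasDerivAt_id t).const_mul (-2)
  exact this.exp.congr_deriv (by ring)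

theorem hasDerivAt_log_two_mul {t : ℝ} (h0 : t ≠ 0) :
    HasDerivAt (fun t => log (2 * t)) (1 / t) t := by
  have : HasDerivAt (fun t : ℝ => 2 * t) 2 t := by
    simpa using (hasDerivAt_id t).const_mul 2
  refine (this.log (by simpa using h0)).congr_deriv ?_
  field_simp

theorem continuous_two_mul_mul_log : Continuous fun t : ℝ => 2 * t * log (2 * t) :=
  continuous_mul_log.comp (continuous_const_mul 2)

theorem continuousOn_polyLog_exp {s : ℕ} (hs : 2 ≤ s) (b : ℝ) :
    ContinuousOn (fun t => polyLog s (exp (-(2 * t)))) (Set.Icc 0 b) := by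
  refine ContinuousOn.polyLog hs (by fun_prop) fun t ht =>
    ⟨by linarith [exp_pos (-(2 * t))], ?_⟩
  rw [exp_le_one_iff]
  linarith [ht.1]

theorem invSinhcIntegral_three_left {b : ℝ} (hb : 0 < b) (h1 : b < 1) :
    2 * invSinhcIntegral 3 b =
      b ^ 2 - 2 * b * log (2 * b) + 2 * b - π ^ 2 / 6 + polyLog 2 (exp (-(2 * b))) := by
  have key := eq_of_hasDerivAt_zero
    (f := fun t => 2 * invSinhcIntegral 3 t - (t ^ 2 - 2 * t * log (2 * t) + 2 * t
      + polyLog 2 (exp (-(2 * t))))) hb ?_ ?_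
  · simp [invSinhcIntegral_succ_zero 2, polyLog_two_one] at key
    linarith
  · refine ((continuousOn_invSinhcIntegral 2 h1).const_mul 2).sub
      (.add (.add (.sub (by fun_prop) continuous_two_mul_mul_log.continuousOn) (by fun_prop))
        (continuousOn_polyLog_exp le_rfl b))
  · rintro t ⟨h0, htb⟩
    have he := exp_neg_two_mul_lt_one h0
    have hp := exp_pos (-(2 * t))
    have dt : HasDerivAt (fun t : ℝ => 2 * t) 2 t := by
      simpa using (hasDerivAt_id t).const_mul 2
    have d := ((hasDerivAt_invSinhcIntegral 2
      (abs_lt.mpr ⟨by linarith, htb.trans h1⟩)).const_mul 2).sub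
      (((((hasDerivAt_id t).pow 2).sub (dt.mul (hasDerivAt_log_two_mul h0.ne'))).add dt).add
        ((hasDerivAt_exp_neg_two_mul t).polyLog 1 (by linarith) he hp.ne'))
    refine d.congr_deriv ?_
    rw [invSinhcIntegral_two_left h0 (htb.trans h1), polyLog_one_left (by linarith) he,
      log_sinh_div h0]
    simp only [id]
    field_simp
    ring

theorem invSinhcIntegral_four_left {b : ℝ} (hb : 0 < b) (h1 : b < 1) :
    4 * invSinhcIntegral 4 b = 2 / 3 * b ^ 3 - 2 * b ^ 2 * log (2 * b) + 3 * b ^ 2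
      - π ^ 2 / 3 * b + polyLog 3 1 - polyLog 3 (exp (-(2 * b))) := by
  -- The grouping `t * (2 * t * log (2 * t))` exposes a factor that is continuous at 0.
  have key := eq_of_hasDerivAt_zero
    (f := fun t => 4 * invSinhcIntegral 4 t - (2 / 3 * t ^ 3 - t * (2 * t * log (2 * t))
      + 3 * t ^ 2 - π ^ 2 / 3 * t - polyLog 3 (exp (-(2 * t))))) hb ?_ ?_
  · simp [invSinhcIntegral_succ_zero 3] at key
    linarith
  · refine ((continuousOn_invSinhcIntegral 3 h1).const_mul 4).sub
      (.sub (.sub (.add (.sub (by fun_prop)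
        (continuous_id.mul continuous_two_mul_mul_log).continuousOn) (by fun_prop)) (by fun_prop))
        (continuousOn_polyLog_exp (by norm_num) b))
  · rintro t ⟨h0, htb⟩
    have he := exp_neg_two_mul_lt_one h0
    have hp := exp_pos (-(2 * t))
    have dt : HasDerivAt (fun t : ℝ => 2 * t) 2 t := by
      simpa using (hasDerivAt_id t).const_mul 2
    have d := ((hasDerivAt_invSinhcIntegral 3
      (abs_lt.mpr ⟨by linarith, htb.trans h1⟩)).const_mul 4).sub
      ((((((hasDerivAt_pow 3 t).const_mul (2 / 3)).sub
        ((hasDerivAt_id t).mul (dt.mul (hasDerivAt_log_two_mul h0.ne')))).add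
        ((hasDerivAt_pow 2 t).const_mul 3)).sub ((hasDerivAt_id t).const_mul (π ^ 2 / 3))).sub
        ((hasDerivAt_exp_neg_two_mul t).polyLog 2 (by linarith) he hp.ne'))
    refine d.congr_deriv ?_
    have h3 := invSinhcIntegral_three_left h0 (htb.trans h1)
    have h4 : 4 * invSinhcIntegral 3 t = 2 * (2 * invSinhcIntegral 3 t) := by ring
    rw [h4, h3]
    simp only [id, Pi.mul_apply]
    field_simp
    push_cast
    ring

/-! ### Closed form of `S` and the six arguments -/

theorem pSeries_eq_polyLog {x : ℝ} (hx : 0 < x) (h2 : x < 2) :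
    24 * pSeries (x / (2 * √6)) = x ^ 3 / 12 - x ^ 2 / 2 * log x + 3 * x ^ 2 / 4
      - π ^ 2 / 6 * x + polyLog 3 1 - polyLog 3 (exp (-x)) := by
  have h := pSeries_div_sqrt (t := x / 2) (by linarith) (by linarith)
  have h4 := invSinhcIntegral_four_left (b := x / 2) (by linarith) (by linarith)
  have e : ∑' k, invSinhcCoeff k / quadDenom k * (x / 2) ^ (2 * k + 4) =
      invSinhcIntegral 4 (x / 2) := by
    refine tsum_congr fun k => ?_
    simp only [integralCoeff, quadDenom]
    push_cast
    rw [div_div, div_div, div_div, add_zero]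
    congr 2
    ring
  rw [e, div_div] at h
  have e2 : 2 * (x / 2) = x := by ring
  rw [e2] at h4
  linear_combination 4 * h + h4

theorem pSeriesConverges_div {x : ℝ} (hx : 0 < x) (h2 : x < 2) :
    PSeriesConverges (x / (2 * √6)) := by
  rw [← div_div]
  exact pSeriesConverges_div_sqrt (by linarith) (by linarith)

theorem log_pos_lt_two {r : ℝ} (h1 : 1 < r) (h2 : r ≤ 2) : 0 < log r ∧ log r < 2 :=
  ⟨log_pos h1, by linarith [log_le_sub_one_of_pos (by linarith : 0 < r)]⟩

theorem sqrt_six : √6 = √2 * √3 := by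
  rw [← sqrt_mul (by norm_num)]
  norm_num

theorem radA_eq : radA = ((2 * (√2 / √3)) / (1 + √2 / √3))⁻¹ := by
  rw [radA]
  field_simp
  ring

theorem radB_eq : radB = 2 / (1 + √2 / √3) := by
  rw [radB]
  field_simp
  ring

theorem radC_eq : radC = ((4 * (√2 / √3)) / (1 + √2 / √3) ^ 2)⁻¹ := by
  have h2 : √2 ^ 2 = 2 := sq_sqrt (by norm_num)
  have h3 : √3 ^ 2 = 3 := sq_sqrt (by norm_num)
  rw [radC, sqrt_six]
  field_simp
  linear_combination -h2 - h3

theorem exp_neg_log_inv {r : ℝ} (h : 0 < r) : exp (-log r⁻¹) = r := by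
  rw [log_inv, neg_neg, exp_log h]

theorem exp_neg_half_log : exp (-(1 / 2 * log (3 / 2))) = √2 / √3 := by
  refine (pow_left_inj₀ (exp_pos _).le (by positivity) two_ne_zero).mp ?_
  rw [← exp_nat_mul, div_pow, sq_sqrt (by norm_num), sq_sqrt (by norm_num)]
  have : ((2 : ℕ) : ℝ) * -(1 / 2 * log (3 / 2)) = -log (2 / 3)⁻¹ := by
    rw [inv_div]
    push_cast
    ring
  rw [this, exp_neg_log_inv (by norm_num)]

theorem mainTheorem8 :
    PSeriesConverges (log (4 / 3) / (2 * √6)) ∧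
    PSeriesConverges (log (9 / 8) / (2 * √6)) ∧
    PSeriesConverges (log (3 / 2) / (4 * √6)) ∧
    PSeriesConverges (log radA / (2 * √6)) ∧
    PSeriesConverges (log radB / (2 * √6)) ∧
    PSeriesConverges (log radC / (2 * √6)) ∧
    riemannZeta 3 = ((
      48 * π ^ 2 / 5 * log (3 / 2) + 6 * π ^ 2 / 5 * log (4 / 3)
      - 2 * π ^ 2 / 5 * log (9 / 8) - 96 * π ^ 2 / 5 * log radA
      - 48 * π ^ 2 / 5 * log radB + 24 * π ^ 2 / 5 * log radC
      - 6 * π ^ 2 / 5 * log 2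
      - 108 / 5 * log (3 / 2) ^ 2 - 27 / 5 * log (4 / 3) ^ 2
      + 9 / 5 * log (9 / 8) ^ 2 + 432 / 5 * log radA ^ 2
      + 432 / 5 * log radB ^ 2 - 108 / 5 * log radC ^ 2
      - 3 / 5 * log (4 / 3) ^ 3 - 6 / 5 * log (3 / 2) ^ 3
      + 1 / 5 * log (9 / 8) ^ 3 + 48 / 5 * log radA ^ 3
      - 48 / 5 * log radB ^ 3 - 12 / 5 * log radC ^ 3
      + 28 / 5 * log 2 ^ 3 - 4 / 5 * log 3 ^ 3
      - 4 / 5 * log (3 / 2) ^ 3 + 8 / 5 * log (4 / 3) ^ 3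
      - 24 / 5 * log (4 / 3) * log 2 ^ 2 + 12 / 5 * log 3 * log (3 / 2) ^ 2
      + 18 / 5 * log (4 / 3) ^ 2 * log (log (4 / 3))
      + 72 / 5 * log (3 / 2) ^ 2 * log (1 / 2 * log (3 / 2))
      - 6 / 5 * log (9 / 8) ^ 2 * log (log (9 / 8))
      - 288 / 5 * log radA ^ 2 * log (log radA)
      - 288 / 5 * log radB ^ 2 * log (log radB)
      + 72 / 5 * log radC ^ 2 * log (log radC)
      + 864 / 5 * pSeries (log (4 / 3) / (2 * √6))
      - 288 / 5 * pSeries (log (9 / 8) / (2 * √6))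
      + 13824 / 5 * pSeries (log (3 / 2) / (4 * √6))
      - 13824 / 5 * pSeries (log radA / (2 * √6))
      - 13824 / 5 * pSeries (log radB / (2 * √6))
      + 3456 / 5 * pSeries (log radC / (2 * √6)) : ℝ) : ℂ) := by
  have h2 : √2 ^ 2 = 2 := sq_sqrt (by norm_num)
  have h3 : √3 ^ 2 = 3 := sq_sqrt (by norm_num)
  obtain ⟨s, hs⟩ : ∃ s, s = √2 / √3 := ⟨_, rfl⟩
  have hs0 : 0 < s := by rw [hs]; positivity
  have hs2 : s ^ 2 = 2 / 3 := by rw [hs, div_pow, h2, h3]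
  have hs1 : s < 1 := by nlinarith
  have hs3 : 4 / 5 < s := by nlinarith
  have eA := radA_eq
  have eB := radB_eq
  have eC := radC_eq
  have eD := exp_neg_half_log
  rw [← hs] at eA eB eC eD
  have bA : 1 < radA ∧ radA ≤ 2 := by
    rw [eA, inv_div, lt_div_iff₀ (by positivity), div_le_iff₀ (by positivity)]
    constructor <;> linarith
  have bB : 1 < radB ∧ radB ≤ 2 := by
    rw [eB, lt_div_iff₀ (by positivity), div_le_iff₀ (by positivity)]
    constructor <;> linarith
  have bC : 1 < radC ∧ radC ≤ 2 := by
    rw [eC, inv_div, lt_div_iff₀ (by positivity), div_le_iff₀ (by positivity)]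
    constructor <;> nlinarith
  have l1 := log_pos_lt_two (r := 4 / 3) (by norm_num) (by norm_num)
  have l2 := log_pos_lt_two (r := 9 / 8) (by norm_num) (by norm_num)
  have l3 := log_pos_lt_two (r := 3 / 2) (by norm_num) (by norm_num)
  have l3' : 0 < 1 / 2 * log (3 / 2) ∧ 1 / 2 * log (3 / 2) < 2 := ⟨by linarith, by linarith⟩
  have lA := log_pos_lt_two bA.1 bA.2
  have lB := log_pos_lt_two bB.1 bB.2
  have lC := log_pos_lt_two bC.1 bC.2
  -- This argument belongs to `x = log (3 / 2) / 2`, for which `exp (-x) = s`.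
  have e3 : log (3 / 2) / (4 * √6) = 1 / 2 * log (3 / 2) / (2 * √6) := by
    field_simp
    norm_num
  rw [e3]
  refine ⟨pSeriesConverges_div l1.1 l1.2, pSeriesConverges_div l2.1 l2.2,
    pSeriesConverges_div l3'.1 l3'.2, pSeriesConverges_div lA.1 lA.2,
    pSeriesConverges_div lB.1 lB.2, pSeriesConverges_div lC.1 lC.2, ?_⟩
  rw [← polyLog_three_one, Complex.ofReal_inj]
  have p1 := pSeries_eq_polyLog l1.1 l1.2
  have p2 := pSeries_eq_polyLog l2.1 l2.2
  have p3 := pSeries_eq_polyLog l3'.1 l3'.2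
  have pA := pSeries_eq_polyLog lA.1 lA.2
  have pB := pSeries_eq_polyLog lB.1 lB.2
  have pC := pSeries_eq_polyLog lC.1 lC.2
  have x1 : exp (-log (4 / 3)) = 3 / 4 := by
    rw [← exp_neg_log_inv (r := 3 / 4) (by norm_num)]
    norm_num
  have x2 : exp (-log (9 / 8)) = 8 / 9 := by
    rw [← exp_neg_log_inv (r := 8 / 9) (by norm_num)]
    norm_num
  have xA : exp (-log radA) = 2 * s / (1 + s) := by
    rw [eA, exp_neg_log_inv (by positivity)]
  have xB : exp (-log radB) = (1 + s) / 2 := by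
    rw [eB, ← inv_div, exp_neg_log_inv (by positivity)]
  have xC : exp (-log radC) = 4 * s / (1 + s) ^ 2 := by
    rw [eC, exp_neg_log_inv (by positivity)]
  have hl := polyLog_three_ladder hs0 hs2
  rw [← eB] at hl
  rw [x1] at p1
  rw [x2] at p2
  rw [eD] at p3
  rw [xA] at pA
  rw [xB] at pB
  rw [xC] at pC
  -- The weights are those of the trilogarithm relation divided by 5, with signs opposite to `hl`,
  -- so all values except `Li₃(1)` cancel.
  linear_combination 1 / 5 * hl - 36 / 5 * p1 + 12 / 5 * p2 - 576 / 5 * p3 + 576 / 5 * pA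
    + 576 / 5 * pB - 144 / 5 * pC
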